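/- Let $x=(x(t))_{t\in\mathbb R}$ be a real, jointly measurable, zero-mean stationary Gaussian process with covariance $\operatorname{Cov}(x(s),x(t))=K_x(s-t)$, where $K_x\in L^1(\mathbb R)\cup L^2(\mathbb R)$. Let $h:\mathbb R\to\mathbb R$ be a filter, $h\in L^1(\mathbb R)\cup L^2(\mathbb R)$, such that for every $t\in\mathbb R$ the integral $$f(t)=\int_{\mathbb R}x(\tau)\,h(\tau-t)\,d\tau=\lim_{R\to\infty}\int_{-R}^{R}x(\tau)\,h(\tau-t)\,d\tau$$ converges in probability (this is the ordinary Lebesgue integral whenever $\tau\mapsto x(\tau)h(\tau-t)$ is almost surely integrable). Let $\sigma_n^2\ge 0$ and, for every $N$, let $t_{N,1},\dots,t_{N,N}\in\mathbb R$ be observation times and $\mathbf y_N=(y_{N,1},\dots,y_{N,N})$ observations with $y_{N,i}\sim\mathcal N(f(t_{N,i}),\sigma_n^2)$, i.e. the residuals $y_{N,i}-f(t_{N,i})$, $i\le N$, are i.i.d. $\mathcal N(0,\sigma_n^2)$ and independent of $x$. For an integrable, compactly supported window $w:\mathbb R\to\mathbb R$ and $\xi\in\mathbb R$ put $$\hat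 x_w(\xi)=\mathcal F[w\,x](\xi)=\int_{\mathbb R}w(t)\,x(t)\,e^{-2\pi i\xi t}\,dt .$$ Suppose that $x$ is successfully recovered from the observations: for every $\xi\in\mathbb R$ and every such window $w$, the posterior variance $$\mathbb E\Big[\big|\hat x_w(\xi)-\mathbb E[\hat x_w(\xi)\mid \mathbf y_N]\big|^2\;\Big|\;\mathbf y_N\Big]$$ tends to $0$ almost surely as $N\to\infty$. Then $$\operatorname{supp}\mathcal F[K_x]\subseteq\operatorname{supp}\mathcal F[h],$$ where $\operatorname{supp}$ is the closed support and $\mathcal F$ is understood in the sense of tempered distributions (for an integrable function $g$, $\operatorname{supp}\mathcal F[g]$ is the closure of $\{\xi:\mathcal F[g](\xi)\neq0\}$). -/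

import Mathlib

open MeasureTheory ProbabilityTheory Filter Topology
open scoped FourierTransform SchwartzMap NNReal

noncomputable section

namespace GPDeconv

/-- The spectral support `supp 𝓕[g]` of a function `g`, for `g` in some `L^p`, `1 ≤ p`: the (closed)
support of the tempered distribution `𝓕[g] : φ ↦ ∫ g(t) (𝓕 φ)(t) dt`. For integrable `g` this is the
closed support of the function `𝓕 g` (`spectralSupport_eq_tsupport`); the distributional form also
gives a meaning to the Fourier transform of non-integrable functions such as the sinc. -/
def spectralSupport (g : ℝ → ℝ) : Set ℝ :=
  Distribution.dsupport fun φ : 𝓢(ℝ, ℂ) ↦ ∫ t, (g t : ℂ) * (𝓕 φ : 𝓢(ℝ, ℂ)) t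

variable {Ω : Type*} [MeasurableSpace Ω]

/-- `x` is a (jointly measurable, real) zero-mean stationary Gaussian process with covariance
kernel `Kx`. -/
structure IsSource (μ : Measure Ω) (x : ℝ → Ω → ℝ) (Kx : ℝ → ℝ) : Prop where
  measurable : Measurable (Function.uncurry x)
  gaussian : IsGaussianProcess x μ
  mean_zero : ∀ t, ∫ ω, x t ω ∂μ = 0
  cov_eq : ∀ s t, cov[x s, x t; μ] = Kx (s - t)

/-- `f(t) = ∫ x(τ) h(τ - t) dτ` for every `t`, as an (improper) integral over `ℝ` that converges in
probability. If `τ ↦ x(τ) h(τ - t)` is almost surely Lebesgue integrable, this is the Lebesgue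
integral. -/
structure IsConvolution (μ : Measure Ω) (x : ℝ → Ω → ℝ) (h : ℝ → ℝ) (f : ℝ → Ω → ℝ) : Prop where
  measurable : ∀ t, Measurable (f t)
  tendsto : ∀ t, TendstoInMeasure μ
    (fun (R : ℝ) ω ↦ ∫ τ in (-R)..R, x τ ω * h (τ - t)) atTop (f t)

/-- `y₁, …, y_N` are noisy observations `yᵢ ∼ 𝒩(f(tᵢ), v)`: the residuals `yᵢ - f(tᵢ)` are
i.i.d. `𝒩(0, v)` and independent of the source process. -/
structure IsObservation (μ : Measure Ω) (x f : ℝ → Ω → ℝ) (v : ℝ≥0) {N : ℕ}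
    (t : Fin N → ℝ) (y : Fin N → Ω → ℝ) : Prop where
  measurable : ∀ i, Measurable (y i)
  law : ∀ i, HasLaw (fun ω ↦ y i ω - f (t i) ω) (gaussianReal 0 v) μ
  indep : iIndepFun (fun i ω ↦ y i ω - f (t i) ω) μ
  indep_source : IndepFun (fun ω τ ↦ x τ ω) (fun ω i ↦ y i ω - f (t i) ω) μ

/-- The windowed spectrum `x̂_w(ξ) = 𝓕[w x](ξ) = ∫ w(t) x(t) e^{-2πiξt} dt`. -/
def windowedSpectrum (x : ℝ → Ω → ℝ) (w : ℝ → ℝ) (ξ : ℝ) (ω : Ω) : ℂ :=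
  𝓕 (fun t : ℝ ↦ ((w t * x t ω : ℝ) : ℂ)) ξ

/-- The posterior variance `E[ |Z - E[Z | y]|² | y ]` of a complex random variable `Z`, given the
observations `y`. -/
def posteriorVariance (μ : Measure Ω) {N : ℕ} (Z : Ω → ℂ) (y : Fin N → Ω → ℝ) : Ω → ℝ :=
  let m : MeasurableSpace Ω := MeasurableSpace.comap (fun ω i ↦ y i ω) MeasurableSpace.pi
  μ[fun ω ↦ ‖Z ω - (μ[Z | m]) ω‖ ^ 2 | m]

/-- Successful recovery of `x` as the number `N` of observations `y N 0, …, y N (N-1)` grows: for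
every frequency and every compactly supported (integrable) window, the posterior variance of the
windowed spectrum tends to zero, almost surely. -/
def SuccessfullyRecovered (μ : Measure Ω) (x : ℝ → Ω → ℝ) (y : (N : ℕ) → Fin N → Ω → ℝ) : Prop :=
  ∀ (ξ : ℝ) (w : ℝ → ℝ), Integrable w → HasCompactSupport w →
    ∀ᵐ ω ∂μ, Tendsto (fun N ↦ posteriorVariance μ (windowedSpectrum x w ξ) (y N) ω) atTop (𝓝 0)

theorem spectralSupport_eq_tsupport {g : ℝ → ℝ} (hg : Integrable g) :
    spectralSupport g = tsupport (𝓕 fun t ↦ (g t : ℂ)) := by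
  set G : ℝ → ℂ := 𝓕 fun t ↦ (g t : ℂ) with hG
  have hgc : Integrable fun t ↦ (g t : ℂ) := hg.ofReal
  have hcont : Continuous G :=
    VectorFourier.fourierIntegral_continuous Real.continuous_fourierChar
      (L := innerₗ ℝ) continuous_inner hgc
  have key (φ : 𝓢(ℝ, ℂ)) : ∫ t, (g t : ℂ) * (𝓕 φ : 𝓢(ℝ, ℂ)) t = ∫ ξ, G ξ * φ ξ := by
    simpa [SchwartzMap.fourier_coe] using! (VectorFourier.integral_fourierIntegral_smul_eq_flip
      (L := innerₗ ℝ) Real.continuous_fourierChar continuous_inner hgc φ.integrable).symm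
  ext ξ
  rw [← not_iff_not, spectralSupport, Distribution.notMem_dsupport_iff]
  constructor
  · rintro ⟨s, hs, hso, hξ⟩
    have h0 : ∀ᵐ u, u ∈ s → G u = 0 := by
      apply hso.ae_eq_zero_of_integral_contDiff_smul_eq_zero
      · exact (hcont.locallyIntegrable).locallyIntegrableOn s
      · intro u hu hu' hus
        have h₁ : HasCompactSupport (Complex.ofRealCLM ∘ u) := hu'.comp_left rfl
        have h₂ : ContDiff ℝ (⊤ : ℕ∞) (Complex.ofRealCLM ∘ u) := by fun_prop
        have h₃ : tsupport (h₁.toSchwartzMap h₂) ⊆ s :=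
          (closure_mono (Function.support_subset_iff'.2 fun z hz ↦ by
            simp [Function.notMem_support.1 hz])).trans hus
        have h₄ := hs (h₁.toSchwartzMap h₂) h₃
        beta_reduce at h₄
        rw [key] at h₄
        simpa [mul_comm] using h₄
    have h1 : Set.EqOn G 0 s := Measure.eqOn_open_of_ae_eq
      ((ae_restrict_iff' hso.measurableSet).2 h0) hso hcont.continuousOn continuousOn_const
    exact notMem_tsupport_iff_eventuallyEq.2 (h1.eventuallyEq_of_mem (hso.mem_nhds hξ))
  · intro hξ
    refine ⟨(tsupport G)ᶜ, fun φ hφ ↦ ?_, (isClosed_tsupport G).isOpen_compl, hξ⟩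
    beta_reduce
    rw [key]
    refine integral_eq_zero_of_ae (ae_of_all _ fun u ↦ ?_)
    by_cases hu : u ∈ tsupport G
    · have : φ u = 0 := image_eq_zero_of_notMem_tsupport fun h ↦ hφ h hu
      simp [this]
    · simp [image_eq_zero_of_notMem_tsupport hu]

end GPDeconv

end

/-! Let `𝓕[h]` vanish on an open set `s`, let `φ` be a test function supported in `s`, and let `γ`
be the real or imaginary part of `𝓕 φ`. The claim is `∫ Kx γ = 0`.

Modulating `φ` keeps its support in `s` and translates `𝓕 φ`, so `h` is orthogonal to every
translate of `γ`. Put `Z = ∫ x γ`. Its covariance with `x(τ)` is `correlation Kx γ τ`, an average of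
translates of `γ` weighted by `Kx`, so by Fubini it is orthogonal to every translate of `h`
(`integral_correlation_mul_eq_zero`). Formally this says that `Z` is uncorrelated with each `f(t)`.
By Gaussianity `Z` is then independent of all observations (`IsSource.indepFun_pathIntegral`,
`indepFun_observation`): the data carry no information about the frequencies in `s`.

Successful recovery makes each `X = ∫ x w` an `L²` limit of `E[X | y_N]`, and each of these is
uncorrelated with `Z`. Hence `E[Z X] = 0` (`integral_mul_eq_zero_of_recovered`). With indicators of
intervals as windows, the integral of `correlation Kx γ` over every interval vanishes.
Differentiating at `0` gives `correlation Kx γ 0 = ∫ Kx γ = 0`. -/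

noncomputable section

namespace GPDeconv

/-! ### Modulation and decay of Schwartz functions -/

section Schwartz

lemma iteratedDeriv_cexp_const_mul_ofReal (c : ℂ) (n : ℕ) :
    iteratedDeriv n (fun ξ : ℝ ↦ Complex.exp (c * ξ)) = fun ξ : ℝ ↦ c ^ n * Complex.exp (c * ξ) := by
  induction n with
  | zero => simp
  | succ n ih =>
    ext ξ
    have h : HasDerivAt (fun ξ : ℝ ↦ c * (ξ : ℂ)) c ξ := by
      simpa using (Complex.ofRealCLM.hasDerivAt (x := ξ)).const_mul c
    rw [iteratedDeriv_succ, ih, (h.cexp.const_mul (c ^ n)).deriv]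
    ring

lemma hasTemperateGrowth_cexp_mul_I (c : ℝ) :
    Function.HasTemperateGrowth fun ξ : ℝ ↦ Complex.exp ((c * Complex.I) * ξ) := by
  refine ⟨((contDiff_const.mul Complex.ofRealCLM.contDiff).cexp), fun n ↦ ⟨0, |c| ^ n, fun ξ ↦ ?_⟩⟩
  rw [norm_iteratedFDeriv_eq_norm_iteratedDeriv, iteratedDeriv_cexp_const_mul_ofReal, norm_mul,
    norm_pow, norm_mul, mul_right_comm, ← Complex.ofReal_mul, Complex.norm_exp_ofReal_mul_I]
  simp

/-- Translates of the Fourier transform of `φ` are Fourier transforms of modulations of `φ`. -/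
lemma exists_fourier_eq_translate (φ : 𝓢(ℝ, ℂ)) (v : ℝ) :
    ∃ ψ : 𝓢(ℝ, ℂ), tsupport ψ ⊆ tsupport φ ∧
      ∀ r, (𝓕 ψ : 𝓢(ℝ, ℂ)) r = (𝓕 φ : 𝓢(ℝ, ℂ)) (r + v) := by
  have ht := hasTemperateGrowth_cexp_mul_I (-2 * Real.pi * v)
  refine ⟨SchwartzMap.smulLeftCLM ℂ
    (fun ξ : ℝ ↦ Complex.exp (((-2 * Real.pi * v : ℝ) * Complex.I) * ξ)) φ, ?_, fun r ↦ ?_⟩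
  · exact (SchwartzMap.tsupport_smulLeftCLM_subset _ _).trans Set.inter_subset_left
  · simp only [SchwartzMap.fourier_coe, Real.fourier_real_eq_integral_exp_smul]
    congr 1 with ξ
    rw [SchwartzMap.smulLeftCLM_apply_apply ht, smul_eq_mul, smul_eq_mul, smul_eq_mul, ← mul_assoc,
      ← Complex.exp_add]
    congr 2
    push_cast
    ring

lemma exists_norm_le_inv_one_add_sq (g : 𝓢(ℝ, ℂ)) : ∃ C, ∀ t, ‖g t‖ ≤ C * (1 + t ^ 2)⁻¹ := by
  obtain ⟨a, ha⟩ := g.decay 0 0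
  obtain ⟨b, hb⟩ := g.decay 2 0
  refine ⟨a + b, fun t ↦ ?_⟩
  have h₁ := ha.2 t
  have h₂ := hb.2 t
  simp only [pow_zero, one_mul, norm_iteratedFDeriv_zero, Real.norm_eq_abs, sq_abs] at h₁ h₂
  rw [← div_eq_mul_inv, le_div_iff₀ (by positivity)]
  linarith

end Schwartz

/-- The Cauchy-Schwarz inequality for the measure with density `|w|`. -/
lemma sq_integral_mul_le {α : Type*} [MeasurableSpace α] {ν : Measure α} {u w : α → ℝ}
    (hw : Integrable w ν) (h₁ : Integrable (fun τ ↦ u τ * w τ) ν)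
    (h₂ : Integrable (fun τ ↦ u τ ^ 2 * |w τ|) ν) :
    (∫ τ, u τ * w τ ∂ν) ^ 2 ≤ (∫ τ, |w τ| ∂ν) * ∫ τ, u τ ^ 2 * |w τ| ∂ν := by
  have h₃ : Integrable (fun τ ↦ |u τ| * |w τ|) ν := by simpa [abs_mul] using h₁.abs
  -- The quadratic `c ↦ ∫ (c - |u|)² |w|` is nonnegative, so its discriminant is nonpositive.
  have key := discrim_le_zero (a := ∫ τ, |w τ| ∂ν) (b := -2 * ∫ τ, |u τ| * |w τ| ∂ν)
    (c := ∫ τ, u τ ^ 2 * |w τ| ∂ν) fun c ↦ by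
      have : 0 ≤ ∫ τ, (c - |u τ|) ^ 2 * |w τ| ∂ν := integral_nonneg fun τ ↦ by positivity
      refine this.trans_eq ?_
      symm
      rw [← integral_mul_const, ← integral_const_mul, ← integral_mul_const,
        ← integral_add (hw.abs.mul_const _) ((h₃.const_mul _).mul_const _),
        ← integral_add (by exact (hw.abs.mul_const _).add ((h₃.const_mul _).mul_const _)) h₂]
      congr 1 with τ
      rw [sub_sq, sq_abs]
      ring
  have h₄ : |∫ τ, u τ * w τ ∂ν| ≤ ∫ τ, |u τ| * |w τ| ∂ν := by
    simpa [abs_mul] using abs_integral_le_integral_abs (f := fun τ ↦ u τ * w τ) (μ := ν)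
  rw [discrim] at key
  have h₅ := pow_le_pow_left₀ (abs_nonneg _) h₄ 2
  rw [sq_abs] at h₅
  linarith

/-- The arithmetic-geometric mean inequality replaces Cauchy-Schwarz: only a bound uniform in a
translation or time parameter is needed later. -/
lemma integral_abs_mul_le_add_sq_div_two {α : Type*} [MeasurableSpace α] {ν : Measure α}
    {X Y : α → ℝ} (hX : MemLp X 2 ν) (hY : MemLp Y 2 ν) :
    ∫ a, |X a * Y a| ∂ν ≤ ((∫ a, X a ^ 2 ∂ν) + ∫ a, Y a ^ 2 ∂ν) / 2 := by
  have h₁ := hX.integrable_sq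
  have h₂ := hY.integrable_sq
  rw [← integral_add h₁ h₂, ← integral_div]
  refine integral_mono (hX.integrable_mul hY).abs ((h₁.add h₂).div_const 2) fun a ↦ ?_
  simp only [abs_mul]
  have := sq_nonneg (|X a| - |Y a|)
  rw [sub_sq, sq_abs, sq_abs] at this
  linarith

/-! ### Second-order theory of the source and its path integrals -/

section Source

variable {Ω : Type*} [MeasurableSpace Ω] {μ : Measure Ω} {x : ℝ → Ω → ℝ} {Kx : ℝ → ℝ}

namespace IsSource

lemma measurable_apply (hx : IsSource μ x Kx) (t : ℝ) : Measurable (x t) :=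
  hx.measurable.comp measurable_prodMk_left

lemma memLp (hx : IsSource μ x Kx) (t : ℝ) : MemLp (x t) 2 μ :=
  (hx.gaussian.hasGaussianLaw_eval t).memLp_two

lemma integral_mul [IsProbabilityMeasure μ] (hx : IsSource μ x Kx) (s t : ℝ) :
    ∫ ω, x s ω * x t ω ∂μ = Kx (s - t) := by
  rw [← hx.cov_eq, covariance_eq_sub (hx.memLp s) (hx.memLp t), hx.mean_zero, zero_mul, sub_zero]
  rfl

lemma integral_sq [IsProbabilityMeasure μ] (hx : IsSource μ x Kx) (t : ℝ) :
    ∫ ω, x t ω ^ 2 ∂μ = Kx 0 := by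
  simpa [sq] using hx.integral_mul t t

lemma integral_abs_mul_le [IsProbabilityMeasure μ] (hx : IsSource μ x Kx) {Y : Ω → ℝ}
    (hY : MemLp Y 2 μ) (t : ℝ) :
    ∫ ω, |Y ω * x t ω| ∂μ ≤ ((∫ ω, Y ω ^ 2 ∂μ) + Kx 0) / 2 := by
  rw [← hx.integral_sq t]
  exact integral_abs_mul_le_add_sq_div_two hY (hx.memLp t)

lemma abs_kernel_le [IsProbabilityMeasure μ] (hx : IsSource μ x Kx) (u : ℝ) : |Kx u| ≤ Kx 0 := by
  have h := hx.integral_abs_mul_le (hx.memLp u) 0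
  rw [hx.integral_sq] at h
  calc |Kx u| = |∫ ω, x u ω * x 0 ω ∂μ| := by rw [hx.integral_mul, sub_zero]
    _ ≤ _ := abs_integral_le_integral_abs
    _ ≤ Kx 0 := by linarith

/-- Joint measurability of the process gives genuine measurability of the kernel, so that `K (t -
τ)` is measurable on the plane. -/
lemma measurable_kernel [IsProbabilityMeasure μ] (hx : IsSource μ x Kx) : Measurable Kx := by
  have : Kx = fun u ↦ ∫ ω, x u ω * x 0 ω ∂μ := by
    ext u
    rw [hx.integral_mul, sub_zero]
  rw [this]
  refine (StronglyMeasurable.integral_prod_right ?_).measurable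
  exact (hx.measurable.mul ((hx.measurable_apply 0).comp measurable_snd)).stronglyMeasurable

end IsSource

lemma inner_toLp {X Y : Ω → ℝ} (hX : MemLp X 2 μ) (hY : MemLp Y 2 μ) :
    inner ℝ (hX.toLp X) (hY.toLp Y) = ∫ ω, X ω * Y ω ∂μ := by
  rw [L2.inner_def]
  refine integral_congr_ae ?_
  filter_upwards [hX.coeFn_toLp, hY.coeFn_toLp] with ω h₁ h₂
  simp [h₁, h₂, mul_comm]

/-- The pathwise integral `∫ x(τ) w(τ) dτ`. -/
def pathIntegral (x : ℝ → Ω → ℝ) (w : ℝ → ℝ) (ω : Ω) : ℝ := ∫ τ, x τ ω * w τ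

namespace IsSource

variable [IsProbabilityMeasure μ]

/-- Justifies Fubini for path integrals: `E|Y x(t)|` is bounded uniformly in `t`, and `w` is
integrable. -/
lemma integrable_prod (hx : IsSource μ x Kx) {Y : Ω → ℝ} (hY : MemLp Y 2 μ) {w : ℝ → ℝ}
    (hw : Integrable w) :
    Integrable (fun p : ℝ × Ω ↦ Y p.2 * (x p.1 p.2 * w p.1)) (volume.prod μ) := by
  have hm : AEStronglyMeasurable (fun p : ℝ × Ω ↦ Y p.2 * (x p.1 p.2 * w p.1)) (volume.prod μ) :=
    hY.1.comp_snd.mul (hx.measurable.aestronglyMeasurable.mul hw.1.comp_fst)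
  refine (integrable_prod_iff hm).2 ⟨ae_of_all _ fun t ↦ ?_, ?_⟩
  · simp only [← mul_assoc]
    exact (hY.integrable_mul (hx.memLp t)).mul_const _
  · refine (hw.norm.const_mul (((∫ ω, Y ω ^ 2 ∂μ) + Kx 0) / 2)).mono'
      hm.norm.integral_prod_right' (ae_of_all _ fun t ↦ ?_)
    rw [Real.norm_of_nonneg (integral_nonneg fun _ ↦ norm_nonneg _)]
    simp only [← mul_assoc, norm_mul (_ * _) (w t)]
    rw [integral_mul_const]
    gcongr
    exact hx.integral_abs_mul_le hY t

lemma integrable_prod_sq (hx : IsSource μ x Kx) {w : ℝ → ℝ} (hw : Integrable w) :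
    Integrable (fun p : ℝ × Ω ↦ x p.1 p.2 ^ 2 * |w p.1|) (volume.prod μ) := by
  have hm : AEStronglyMeasurable (fun p : ℝ × Ω ↦ x p.1 p.2 ^ 2 * |w p.1|) (volume.prod μ) :=
    (hx.measurable.pow_const 2).aestronglyMeasurable.mul hw.1.norm.comp_fst
  refine (integrable_prod_iff hm).2 ⟨ae_of_all _ fun t ↦ ?_, ?_⟩
  · exact (hx.memLp t).integrable_sq.mul_const |w t|
  · refine (hw.norm.const_mul (Kx 0)).congr (ae_of_all _ fun t ↦ ?_)
    simp [integral_mul_const, hx.integral_sq]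

lemma ae_integrable_path (hx : IsSource μ x Kx) {w : ℝ → ℝ} (hw : Integrable w) :
    ∀ᵐ ω ∂μ, Integrable fun τ ↦ x τ ω * w τ := by
  simpa using (hx.integrable_prod (memLp_const (1 : ℝ)) hw).prod_left_ae

lemma integral_mul_pathIntegral (hx : IsSource μ x Kx) {Y : Ω → ℝ} (hY : MemLp Y 2 μ) {w : ℝ → ℝ}
    (hw : Integrable w) :
    ∫ ω, Y ω * pathIntegral x w ω ∂μ = ∫ τ, (∫ ω, Y ω * x τ ω ∂μ) * w τ := by
  simp only [pathIntegral, ← integral_const_mul, ← integral_mul_const]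
  rw [← integral_integral_swap (hx.integrable_prod hY hw)]
  simp only [mul_assoc]

lemma memLp_pathIntegral (hx : IsSource μ x Kx) {w : ℝ → ℝ} (hw : Integrable w) :
    MemLp (pathIntegral x w) 2 μ := by
  have hm : AEStronglyMeasurable (pathIntegral x w) μ := by
    have := (hx.integrable_prod (memLp_const (1 : ℝ)) hw).integral_prod_right.1
    simpa [pathIntegral] using! this
  have hsq := hx.integrable_prod_sq hw
  refine (memLp_two_iff_integrable_sq hm).2 ?_
  refine (hsq.integral_prod_right.const_mul (∫ τ, |w τ|)).mono' (hm.pow 2) ?_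
  filter_upwards [hx.ae_integrable_path hw, hsq.prod_left_ae] with ω h₁ h₂
  rw [Real.norm_of_nonneg (sq_nonneg _)]
  exact sq_integral_mul_le hw h₁ h₂

/-- The Gaussian Hilbert space of the process: the closed linear span of its values in `L²`. -/
def gaussianSpace (hx : IsSource μ x Kx) : Submodule ℝ (Lp ℝ 2 μ) :=
  (Submodule.span ℝ (Set.range fun t ↦ (hx.memLp t).toLp (x t))).topologicalClosure

/-- By Fubini, anything orthogonal to all `x(t)` is orthogonal to the path integral, which therefore
lies in the double orthogonal complement, the closed span. No Riemann sums are needed. -/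
lemma toLp_pathIntegral_mem (hx : IsSource μ x Kx) {w : ℝ → ℝ} (hw : Integrable w) :
    (hx.memLp_pathIntegral hw).toLp _ ∈ hx.gaussianSpace := by
  rw [gaussianSpace, ← Submodule.orthogonal_orthogonal_eq_closure, Submodule.mem_orthogonal]
  intro Y hY
  have hY' (t : ℝ) : ∫ ω, Y ω * x t ω ∂μ = 0 := by
    rw [Submodule.mem_orthogonal'] at hY
    have := hY _ (Submodule.subset_span ⟨t, rfl⟩)
    rwa [← Lp.toLp_coeFn Y (Lp.memLp Y), inner_toLp] at this
  rw [← Lp.toLp_coeFn Y (Lp.memLp Y), inner_toLp, hx.integral_mul_pathIntegral (Lp.memLp Y) hw]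
  simp [hY']

end IsSource

end Source

/-! ### Independence from asymptotic orthogonality -/

section Independence

variable {Ω : Type*} [MeasurableSpace Ω] {μ : Measure Ω}

lemma tendsto_integral_cexp_mul [IsFiniteMeasure μ] {u : ℕ → Ω → ℝ} {u₀ : Ω → ℝ}
    (hu : ∀ n, AEStronglyMeasurable (u n) μ) {B : Ω → ℂ} (hBm : AEStronglyMeasurable B μ)
    (hB : ∀ ω, ‖B ω‖ ≤ 1) (h : ∀ᵐ ω ∂μ, Tendsto (fun n ↦ u n ω) atTop (𝓝 (u₀ ω))) :
    Tendsto (fun n ↦ ∫ ω, Complex.exp (u n ω * Complex.I) * B ω ∂μ) atTop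
      (𝓝 (∫ ω, Complex.exp (u₀ ω * Complex.I) * B ω ∂μ)) := by
  refine tendsto_integral_of_dominated_convergence (fun _ ↦ 1) (fun n ↦ ?_) (integrable_const _)
    (fun n ↦ ae_of_all _ fun ω ↦ ?_) ?_
  · have hc : Continuous fun r : ℝ ↦ Complex.exp (r * Complex.I) := by fun_prop
    exact (hc.comp_aestronglyMeasurable (hu n)).mul hBm
  · simpa [Complex.norm_exp_ofReal_mul_I] using hB ω
  · filter_upwards [h] with ω hω
    have hc : Continuous fun r : ℝ ↦ Complex.exp (r * Complex.I) := by fun_prop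
    exact ((hc.tendsto _).comp hω).mul_const _

/-- Finitely many sequences that converge in measure have a common almost everywhere convergent
subsequence. -/
lemma exists_common_seq_tendsto_ae {ι : Type*} [Finite ι] {F : ℕ → ι → Ω → ℝ} {f : ι → Ω → ℝ}
    (h : ∀ i, TendstoInMeasure μ (fun n ↦ F n i) atTop (f i)) :
    ∃ ns : ℕ → ℕ, StrictMono ns ∧
      ∀ᵐ ω ∂μ, ∀ i, Tendsto (fun k ↦ F (ns k) i ω) atTop (𝓝 (f i ω)) := by
  classical
  have := Fintype.ofFinite ι
  have key (s : Finset ι) : ∃ ns : ℕ → ℕ, StrictMono ns ∧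
      ∀ i ∈ s, ∀ᵐ ω ∂μ, Tendsto (fun k ↦ F (ns k) i ω) atTop (𝓝 (f i ω)) := by
    induction s using Finset.induction_on with
    | empty => exact ⟨id, strictMono_id, by simp⟩
    | insert j s hj ih =>
      obtain ⟨ns, hns, hs⟩ := ih
      obtain ⟨ms, hms, hm⟩ := ((h j).comp hns.tendsto_atTop).exists_seq_tendsto_ae
      refine ⟨ns ∘ ms, hns.comp hms, fun i hi ↦ ?_⟩
      obtain rfl | hi := Finset.mem_insert.1 hi
      · exact hm
      · filter_upwards [hs i hi] with ω hω using hω.comp hms.tendsto_atTop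
  obtain ⟨ns, hns, hs⟩ := key Finset.univ
  exact ⟨ns, hns, ae_all_iff.2 fun i ↦ hs i (Finset.mem_univ i)⟩

lemma coeFn_sum_smul_toLp {ι : Type*} (s : Finset ι) (b : ι → ℝ) {X : ι → Ω → ℝ}
    (hX : ∀ i, MemLp (X i) 2 μ) :
    (∑ i ∈ s, b i • (hX i).toLp (X i) : Lp ℝ 2 μ) =ᵐ[μ] fun ω ↦ ∑ i ∈ s, b i * X i ω := by
  classical
  induction s using Finset.induction_on with
  | empty => simpa using! Lp.coeFn_zero ℝ 2 μ
  | insert j s hj ih =>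
    rw [Finset.sum_insert hj]
    filter_upwards [Lp.coeFn_add (b j • (hX j).toLp (X j)) (∑ i ∈ s, b i • (hX i).toLp (X i)),
      Lp.coeFn_smul (b j) ((hX j).toLp (X j)), (hX j).coeFn_toLp, ih] with ω h₁ h₂ h₃ h₄
    rw [h₁, Pi.add_apply, h₂, Pi.smul_apply, h₃, h₄, Finset.sum_insert hj, smul_eq_mul]

namespace IsSource

variable [IsProbabilityMeasure μ] {x : ℝ → Ω → ℝ} {Kx : ℝ → ℝ}

/-- A finite combination of values of `x` is a centred Gaussian whose variance is its squared `L²`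
norm, and it is independent of `B`, so the expectation factors. -/
lemma integral_cexp_mul_of_mem_span (hx : IsSource μ x Kx) {B : Ω → ℂ} (hBm : Measurable B)
    (hind : IndepFun (fun ω τ ↦ x τ ω) B μ) {u : Lp ℝ 2 μ}
    (hu : u ∈ Submodule.span ℝ (Set.range fun t ↦ (hx.memLp t).toLp (x t))) :
    ∫ ω, Complex.exp (u ω * Complex.I) * B ω ∂μ =
      Complex.exp (-(‖u‖ ^ 2 / 2 : ℝ)) * ∫ ω, B ω ∂μ := by
  obtain ⟨c, rfl⟩ := Finsupp.mem_span_range_iff_exists_finsupp.1 hu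
  set v : Ω → ℝ := fun ω ↦ ∑ t ∈ c.support, c t * x t ω with hv
  have hvG : HasGaussianLaw v μ := (hx.gaussian.smul c).hasGaussianLaw_fun_sum (I := c.support)
  have huv : c.sum (fun t a ↦ a • (hx.memLp t).toLp (x t)) = hvG.memLp_two.toLp v := by
    refine Lp.ext ?_
    exact (coeFn_sum_smul_toLp c.support c hx.memLp).trans hvG.memLp_two.coeFn_toLp.symm
  rw [huv]
  have hmean : ∫ ω, v ω ∂μ = 0 := by
    rw [hv, integral_finsetSum _ fun t _ ↦ ((hx.memLp t).integrable one_le_two).const_mul _]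
    simp [integral_const_mul, hx.mean_zero]
  have hnorm : ‖hvG.memLp_two.toLp v‖ ^ 2 = Var[v; μ] := by
    rw [← real_inner_self_eq_norm_sq, inner_toLp, variance_of_integral_eq_zero hvG.aemeasurable
      hmean]
    simp [sq]
  have hchar : ∫ ω, Complex.exp (v ω * Complex.I) ∂μ = Complex.exp (-(Var[v; μ] / 2 : ℝ)) := by
    have := hvG.charFun_map_eq 1
    rw [charFun_apply_real, integral_map hvG.aemeasurable (by fun_prop)] at this
    simpa [hmean, neg_div] using this
  have hvB : IndepFun (fun ω ↦ Complex.exp (v ω * Complex.I)) B μ := by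
    have hm : Measurable fun p : ℝ → ℝ ↦
        Complex.exp ((∑ t ∈ c.support, c t * p t : ℝ) * Complex.I) := by fun_prop
    exact hind.comp hm measurable_id
  have hvm : AEStronglyMeasurable (fun ω ↦ Complex.exp (v ω * Complex.I)) μ := by
    have hc : Continuous fun r : ℝ ↦ Complex.exp (r * Complex.I) := by fun_prop
    exact hc.comp_aestronglyMeasurable hvG.memLp_two.1
  rw [hnorm, ← hchar, ← hvB.integral_fun_mul_eq_mul_integral hvm hBm.aestronglyMeasurable]
  refine integral_congr_ae ?_
  filter_upwards [hvG.memLp_two.coeFn_toLp] with ω hω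
  rw [hω]

/-- The characteristic function of an element of the Gaussian space, twisted by an independent
bounded factor. -/
lemma integral_cexp_mul_of_mem (hx : IsSource μ x Kx) {B : Ω → ℂ} (hBm : Measurable B)
    (hB : ∀ ω, ‖B ω‖ ≤ 1) (hind : IndepFun (fun ω τ ↦ x τ ω) B μ) {u : Lp ℝ 2 μ}
    (hu : u ∈ hx.gaussianSpace) :
    ∫ ω, Complex.exp (u ω * Complex.I) * B ω ∂μ =
      Complex.exp (-(‖u‖ ^ 2 / 2 : ℝ)) * ∫ ω, B ω ∂μ := by
  rw [gaussianSpace, ← SetLike.mem_coe, Submodule.topologicalClosure_coe,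
    mem_closure_iff_seq_limit] at hu
  obtain ⟨un, hmem, hlim⟩ := hu
  obtain ⟨ns, hns, hae⟩ := (tendstoInMeasure_of_tendsto_Lp hlim).exists_seq_tendsto_ae
  have h₁ := tendsto_integral_cexp_mul (fun k ↦ Lp.aestronglyMeasurable (un (ns k)))
    hBm.aestronglyMeasurable hB hae
  refine tendsto_nhds_unique h₁ ?_
  simp only [hx.integral_cexp_mul_of_mem_span hBm hind (hmem _)]
  have hc : Continuous fun w : Lp ℝ 2 μ ↦ Complex.exp (-(‖w‖ ^ 2 / 2 : ℝ)) := by fun_prop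
  exact ((hc.tendsto _).comp (hlim.comp hns.tendsto_atTop)).mul_const _

/-- A path integral that is asymptotically uncorrelated with path integrals converging in
probability is independent of noisy observations of their limits. -/
lemma indepFun_pathIntegral (hx : IsSource μ x Kx) {ι : Type*} [Fintype ι] {w : ℝ → ℝ}
    (hw : Integrable w) {g : ℕ → ι → ℝ → ℝ} (hg : ∀ n i, Integrable (g n i)) {f n : ι → Ω → ℝ}
    (hf : ∀ i, Measurable (f i)) (hn : ∀ i, Measurable (n i))
    (hind : IndepFun (fun ω τ ↦ x τ ω) (fun ω i ↦ n i ω) μ)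
    (hlim : ∀ i, TendstoInMeasure μ (fun k ↦ pathIntegral x (g k i)) atTop (f i))
    (horth : ∀ i, Tendsto (fun k ↦ ∫ ω, pathIntegral x w ω * pathIntegral x (g k i) ω ∂μ)
      atTop (𝓝 0)) :
    IndepFun (pathIntegral x w) (fun ω i ↦ f i ω + n i ω) μ := by
  classical
  have hZ := hx.memLp_pathIntegral hw
  have hP (k : ℕ) (i : ι) := hx.memLp_pathIntegral (hg k i)
  have hy : Measurable fun ω i ↦ f i ω + n i ω :=
    measurable_pi_lambda _ fun i ↦ (hf i).add (hn i)
  -- Independence is tested on joint characteristic functions. A functional `L` on the product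
  -- splits as `a * z + ℓ p`; the noise part of `ℓ` goes into the bounded factor `B`, which is
  -- independent of `x`.
  refine (indepFun_iff_charFunDual_prod hZ.1.aemeasurable hy.aemeasurable).2 fun L ↦ ?_
  set a : ℝ := L (1, 0) with ha
  set ℓ : StrongDual ℝ (ι → ℝ) := L.comp (.inr ℝ ℝ (ι → ℝ)) with hℓ
  set b : ι → ℝ := fun i ↦ ℓ (Pi.single i 1) with hb
  have hL (z : ℝ) (p : ι → ℝ) : L (z, p) = a * z + ℓ p := by
    have : ((z, p) : ℝ × (ι → ℝ)) = z • (1, 0) + (0, p) := by simp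
    rw [this, map_add, map_smul, smul_eq_mul, mul_comm]
    rfl
  have hL' (z : ℝ) : L.comp (.inl ℝ ℝ (ι → ℝ)) z = a * z := by simpa using hL z 0
  have hℓb (p : ι → ℝ) : ℓ p = ∑ i, b i * p i := by
    conv_lhs => rw [pi_eq_sum_univ' p]
    simp [hb, mul_comm, Pi.single]
  set B : Ω → ℂ := fun ω ↦ Complex.exp (ℓ (fun i ↦ n i ω) * Complex.I) with hBdef
  have hBm : Measurable B := by fun_prop
  have hB (ω : Ω) : ‖B ω‖ ≤ 1 := (Complex.norm_exp_ofReal_mul_I _).le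
  have hBind : IndepFun (fun ω τ ↦ x τ ω) B μ := by
    have hm : Measurable fun p : ι → ℝ ↦ Complex.exp (ℓ p * Complex.I) := by fun_prop
    exact hind.comp measurable_id hm
  set Z : Lp ℝ 2 μ := hZ.toLp _
  have hZmem : Z ∈ hx.gaussianSpace := hx.toLp_pathIntegral_mem hw
  set F : ℕ → Lp ℝ 2 μ := fun k ↦ ∑ i, b i • (hP k i).toLp _ with hF
  have hFmem (k : ℕ) : F k ∈ hx.gaussianSpace :=
    Submodule.sum_mem _ fun i _ ↦ Submodule.smul_mem _ _ (hx.toLp_pathIntegral_mem (hg k i))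
  have hFae (k : ℕ) : F k =ᵐ[μ] fun ω ↦ ℓ fun i ↦ pathIntegral x (g k i) ω := by
    refine (coeFn_sum_smul_toLp Finset.univ b fun i ↦ hP k i).trans (ae_of_all _ fun ω ↦ ?_)
    exact (hℓb _).symm
  -- Expanding `‖c • Z + F k‖²`, only the cross term `c⟪Z, F k⟫` prevents factorization, and it
  -- tends to `0`.
  have hfactor (c : ℝ) (k : ℕ) : ∫ ω, Complex.exp ((c • Z + F k : Lp ℝ 2 μ) ω * Complex.I) * B ω ∂μ
      = Complex.exp (-(‖c • Z‖ ^ 2 / 2 : ℝ)) * Complex.exp (-(c * inner ℝ Z (F k) : ℝ)) *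
        ∫ ω, Complex.exp (F k ω * Complex.I) * B ω ∂μ := by
    rw [hx.integral_cexp_mul_of_mem hBm hB hBind (Submodule.add_mem _
      (Submodule.smul_mem _ c hZmem) (hFmem k)), hx.integral_cexp_mul_of_mem hBm hB hBind (hFmem k),
      ← mul_assoc, ← Complex.exp_add, ← Complex.exp_add, norm_add_sq_real, real_inner_smul_left]
    congr 2
    push_cast
    ring
  have hinner : Tendsto (fun k ↦ inner ℝ Z (F k)) atTop (𝓝 0) := by
    have h (k : ℕ) : inner ℝ Z (F k) =
        ∑ i, b i * ∫ ω, pathIntegral x w ω * pathIntegral x (g k i) ω ∂μ := by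
      rw [hF, inner_sum]
      simp only [real_inner_smul_right, Z, inner_toLp]
    simp only [h]
    simpa using tendsto_finsetSum Finset.univ fun i _ ↦ (horth i).const_mul (b i)
  -- The limits `f i` are only known in probability. Almost sure convergence along a common
  -- subsequence suffices to pass to the limit in the bounded exponentials.
  obtain ⟨ns, hns, hae⟩ := exists_common_seq_tendsto_ae hlim
  have hlimF : ∀ᵐ ω ∂μ, Tendsto (fun k ↦ F (ns k) ω) atTop (𝓝 (ℓ fun i ↦ f i ω)) := by
    filter_upwards [hae, ae_all_iff.2 hFae] with ω h₁ h₂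
    simp only [h₂]
    exact (ℓ.continuous.tendsto _).comp (tendsto_pi_nhds.2 h₁)
  have hlimA : ∀ᵐ ω ∂μ, Tendsto (fun k ↦ (a • Z + F (ns k) : Lp ℝ 2 μ) ω) atTop
      (𝓝 (a * pathIntegral x w ω + ℓ fun i ↦ f i ω)) := by
    filter_upwards [hlimF, ae_all_iff.2 fun k ↦ Lp.coeFn_add (a • Z) (F (ns k)),
      Lp.coeFn_smul a Z, hZ.coeFn_toLp] with ω h₁ h₂ h₃ h₄
    simp only [h₂, Pi.add_apply, h₃, Pi.smul_apply, smul_eq_mul]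
    rw [h₄]
    exact h₁.const_add _
  have hE₁ := tendsto_integral_cexp_mul (fun k ↦ Lp.aestronglyMeasurable _)
    hBm.aestronglyMeasurable hB hlimA
  have hE₂ := tendsto_integral_cexp_mul (fun k ↦ Lp.aestronglyMeasurable _)
    hBm.aestronglyMeasurable hB hlimF
  have hexp : Tendsto (fun k ↦ Complex.exp (-(a * inner ℝ Z (F (ns k)) : ℝ))) atTop (𝓝 1) := by
    have hc : Continuous fun r : ℝ ↦ Complex.exp (-(a * r : ℝ)) := by fun_prop
    simpa using! (hc.tendsto 0).comp (hinner.comp hns.tendsto_atTop)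
  have hE := tendsto_nhds_unique hE₁
    (((hexp.const_mul (Complex.exp (-(‖a • Z‖ ^ 2 / 2 : ℝ)))).mul hE₂).congr
      fun k ↦ (hfactor a (ns k)).symm)
  have hZchar : ∫ ω, Complex.exp ((a * pathIntegral x w ω : ℝ) * Complex.I) ∂μ =
      Complex.exp (-(‖a • Z‖ ^ 2 / 2 : ℝ)) := by
    have h := hx.integral_cexp_mul_of_mem (B := fun _ ↦ 1) measurable_const (by simp)
      (indepFun_const_right _ _) (Submodule.smul_mem _ a hZmem)
    simp only [mul_one, integral_const, probReal_univ, one_smul] at h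
    rw [← h]
    refine integral_congr_ae ?_
    filter_upwards [Lp.coeFn_smul a Z, hZ.coeFn_toLp] with ω h₃ h₄
    rw [h₃, Pi.smul_apply, smul_eq_mul, h₄]
  have hsum (ω : Ω) : ℓ (fun i ↦ f i ω + n i ω) = ℓ (fun i ↦ f i ω) + ℓ (fun i ↦ n i ω) :=
    map_add ℓ (fun i ↦ f i ω) _
  simp only [charFunDual_apply]
  rw [integral_map (hZ.1.aemeasurable.prodMk hy.aemeasurable) (by fun_prop),
    integral_map hZ.1.aemeasurable (by fun_prop), integral_map hy.aemeasurable (by fun_prop)]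
  simp only [hL, hL', hZchar, hsum]
  rw [mul_one] at hE
  simp only [hBdef, ← Complex.exp_add, ← add_mul, ← Complex.ofReal_add] at hE
  simpa only [add_assoc] using hE

end IsSource

end Independence

/-! ### Recovered variables and orthogonality to what is independent of the data -/

section Recovery

variable {Ω : Type*} [MeasurableSpace Ω] {μ : Measure Ω}

/-- Conditional expectation commutes with the continuous linear embedding of `ℝ` into `ℂ`. -/
lemma posteriorVariance_ofReal {N : ℕ} {X : Ω → ℝ} (hX : Integrable X μ) (y : Fin N → Ω → ℝ) :
    posteriorVariance μ (fun ω ↦ (X ω : ℂ)) y =ᵐ[μ]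
      Var[X; μ | MeasurableSpace.comap (fun ω i ↦ y i ω) MeasurableSpace.pi] := by
  refine condExp_congr_ae ?_
  filter_upwards [Complex.ofRealCLM.comp_condExp_comm hX
    (m := MeasurableSpace.comap (fun ω i ↦ y i ω) MeasurableSpace.pi)] with ω hω
  have h : (μ[fun ω ↦ (X ω : ℂ) | MeasurableSpace.comap (fun ω i ↦ y i ω) MeasurableSpace.pi]) ω
    = _ := hω.symm
  rw [h]
  simp [← Complex.ofReal_sub, sq_abs]

lemma UnifIntegrable.mono_ae {ι : Type*} {u v : ι → Ω → ℝ} (hv : UnifIntegrable v 1 μ)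
    (h : ∀ i, ∀ᵐ ω ∂μ, ‖u i ω‖ ≤ ‖v i ω‖) : UnifIntegrable u 1 μ := by
  intro ε hε
  obtain ⟨δ, hδ, H⟩ := hv hε
  refine ⟨δ, hδ, fun i s hs hμ ↦ (eLpNorm_mono_ae ?_).trans (H i s hs hμ)⟩
  filter_upwards [h i] with ω hω
  rw [norm_indicator_eq_indicator_norm, norm_indicator_eq_indicator_norm]
  exact Set.indicator_le_indicator hω

variable [IsProbabilityMeasure μ]

/-- If the conditional variances of `X` tend to zero almost surely, so do their means. -/
lemma tendsto_integral_condVar {m : ℕ → MeasurableSpace Ω}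
    (hm : ∀ N, m N ≤ (inferInstance : MeasurableSpace Ω)) {X : Ω → ℝ} (hX : MemLp X 2 μ)
    (h : ∀ᵐ ω ∂μ, Tendsto (fun N ↦ Var[X; μ | m N] ω) atTop (𝓝 0)) :
    Tendsto (fun N ↦ ∫ ω, (X ω - (μ[X | m N]) ω) ^ 2 ∂μ) atTop (𝓝 0) := by
  -- The conditional variances are dominated by `E[X² | m N]`, a uniformly integrable family, so
  -- Vitali's theorem upgrades almost sure convergence to `L¹`.
  have hui : UnifIntegrable (fun N ↦ Var[X; μ | m N]) 1 μ := by
    have hsq : Integrable (X ^ 2) μ := hX.integrable_sq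
    refine UnifIntegrable.mono_ae (hsq.uniformIntegrable_condExp hm).2.1 fun N ↦ ?_
    have h0 : 0 ≤ᵐ[μ] Var[X; μ | m N] := condExp_nonneg (ae_of_all _ fun ω ↦ sq_nonneg _)
    filter_upwards [h0, condVar_ae_le_condExp_sq (hm N) hX] with ω h₁ h₂
    have h₁' : 0 ≤ (Var[X; μ | m N]) ω := h₁
    rw [Real.norm_of_nonneg h₁', Real.norm_of_nonneg (h₁'.trans h₂)]
    exact h₂
  have hL := tendsto_Lp_finite_of_tendsto_ae le_rfl ENNReal.one_ne_top
    (fun N ↦ (integrable_condVar (m := m N)).1) (MemLp.zero (p := 1) (ε := ℝ)) hui h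
  have := tendsto_integral_of_L1' (0 : Ω → ℝ) aestronglyMeasurable_zero
    (Eventually.of_forall fun N ↦ integrable_condVar (m := m N) (X := X)) hL
  simp only [Pi.zero_apply, integral_zero] at this
  refine this.congr fun N ↦ ?_
  exact integral_condExp (hm N)

/-- A centred variable that is independent of all observations is uncorrelated with every variable
that is recovered from them. -/
lemma integral_mul_eq_zero_of_recovered {X Z : Ω → ℝ} (hX : MemLp X 2 μ) (hZ : MemLp Z 2 μ)
    (hZ0 : ∫ ω, Z ω ∂μ = 0) {y : (N : ℕ) → Fin N → Ω → ℝ} (hy : ∀ N i, Measurable (y N i))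
    (hind : ∀ N, IndepFun Z (fun ω i ↦ y N i ω) μ)
    (h : ∀ᵐ ω ∂μ, Tendsto (fun N ↦ posteriorVariance μ (fun ω ↦ (X ω : ℂ)) (y N) ω) atTop (𝓝 0)) :
    ∫ ω, Z ω * X ω ∂μ = 0 := by
  set m : ℕ → MeasurableSpace Ω := fun N ↦
    MeasurableSpace.comap (fun ω i ↦ y N i ω) MeasurableSpace.pi with hmdef
  have hm (N : ℕ) : m N ≤ (inferInstance : MeasurableSpace Ω) :=
    (measurable_pi_lambda _ fun i ↦ hy N i).comap_le
  have hX1 : Integrable X μ := hX.integrable one_le_two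
  have hlim := tendsto_integral_condVar hm hX (by
    filter_upwards [h, ae_all_iff.2 fun N ↦ posteriorVariance_ofReal hX1 (y N)] with ω h₁ h₂
    exact h₁.congr h₂)
  have hc (N : ℕ) : MemLp (μ[X | m N]) 2 μ := hX.condExp one_le_two
  have hzero (N : ℕ) : ∫ ω, Z ω * (μ[X | m N]) ω ∂μ = 0 := by
    have hi : IndepFun Z (μ[X | m N]) μ := by
      rw [IndepFun_iff_Indep]
      exact indep_of_indep_of_le_right ((IndepFun_iff_Indep _ _ _).1 (hind N))
        stronglyMeasurable_condExp.measurable.comap_le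
    rw [hi.integral_fun_mul_eq_mul_integral hZ.1 (hc N).1, hZ0, zero_mul]
  -- Cauchy-Schwarz, after subtracting from `X` its conditional expectation, which is uncorrelated
  -- with `Z`.
  have hle (N : ℕ) : (∫ ω, Z ω * X ω ∂μ) ^ 2 ≤
      (∫ ω, Z ω ^ 2 ∂μ) * ∫ ω, (X ω - (μ[X | m N]) ω) ^ 2 ∂μ := by
    have hd : MemLp (fun ω ↦ X ω - (μ[X | m N]) ω) 2 μ := hX.sub (hc N)
    have h₁ : ∫ ω, Z ω * X ω ∂μ = ∫ ω, Z ω * (X ω - (μ[X | m N]) ω) ∂μ := by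
      simp only [mul_sub]
      rw [integral_sub (by exact hZ.integrable_mul hX) (by exact hZ.integrable_mul (hc N)), hzero, sub_zero]
    have h₂ := real_inner_mul_inner_self_le (hZ.toLp Z) (hd.toLp _)
    simp only [inner_toLp, ← sq] at h₂
    rwa [h₁]
  have := ge_of_tendsto' (hlim.const_mul (∫ ω, Z ω ^ 2 ∂μ)) hle
  rw [mul_zero] at this
  exact pow_eq_zero_iff two_ne_zero |>.1 (le_antisymm this (sq_nonneg _))

end Recovery

/-! ### Correlation with the kernel -/

section Correlation

/-- The covariance of `∫ x(t) γ(t) dt` with `x(τ)`. -/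
def correlation (K γ : ℝ → ℝ) (τ : ℝ) : ℝ := ∫ t, K (t - τ) * γ t

/-- Moves the shift from `K`, which need not be continuous, to `γ`. -/
lemma correlation_eq (K γ : ℝ → ℝ) (τ : ℝ) : correlation K γ τ = ∫ u, K u * γ (u + τ) := by
  simpa [correlation] using (integral_sub_right_eq_self (fun u ↦ K u * γ (u + τ)) τ)

lemma measurable_correlation {K γ : ℝ → ℝ} (hK : Measurable K) (hγ : Measurable γ) :
    Measurable (correlation K γ) := by
  refine (StronglyMeasurable.integral_prod_right (f := fun τ t ↦ K (t - τ) * γ t) ?_).measurable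
  exact ((hK.comp (measurable_snd.sub measurable_fst)).mul
    (hγ.comp measurable_snd)).stronglyMeasurable

lemma continuousAt_correlation {K γ : ℝ → ℝ} {M C : ℝ} (hK : Measurable K) (hM : ∀ u, |K u| ≤ M)
    (hγ : Continuous γ) (hC : ∀ t, |γ t| ≤ C * (1 + t ^ 2)⁻¹) :
    ContinuousAt (correlation K γ) 0 := by
  have hC0 : 0 ≤ C := by simpa using (abs_nonneg _).trans (hC 0)
  have hM0 : 0 ≤ M := (abs_nonneg _).trans (hM 0)
  have : correlation K γ = fun τ ↦ ∫ u, K u * γ (u + τ) := funext (correlation_eq K γ)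
  rw [this]
  -- For `|τ| ≤ 1`, `u² ≤ 2(u + τ)² + 2τ²` gives `1 + u² ≤ 4(1 + (u + τ)²)`, whence the factor `4`.
  refine continuousAt_of_dominated (bound := fun u ↦ M * (C * (4 * (1 + u ^ 2)⁻¹)))
    (Eventually.of_forall fun τ ↦ ?_) ?_ ?_ (ae_of_all _ fun u ↦ ?_)
  · exact (hK.mul (hγ.measurable.comp (measurable_id.add_const τ))).aestronglyMeasurable
  · filter_upwards [Metric.ball_mem_nhds (0 : ℝ) one_pos] with τ hτ
    refine ae_of_all _ fun u ↦ ?_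
    have hτ1 : τ ^ 2 ≤ 1 := by
      rw [mem_ball_zero_iff, Real.norm_eq_abs] at hτ
      exact (sq_le_one_iff_abs_le_one τ).2 hτ.le
    rw [norm_mul]
    refine mul_le_mul (hM u) ((hC _).trans ?_) (norm_nonneg _) hM0
    refine mul_le_mul_of_nonneg_left ?_ hC0
    rw [← div_eq_mul_inv, inv_eq_one_div, div_le_div_iff₀ (by positivity) (by positivity)]
    nlinarith [sq_nonneg (u + 2 * τ)]
  · exact ((integrable_inv_one_add_sq.const_mul 4).const_mul C).const_mul M
  · exact (continuous_const.mul (hγ.comp (continuous_const.add continuous_id))).continuousAt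

/-- For `h` in `L¹`, a bounded kernel multiplies the integrable product of `h` and `γ`. For `h` in
`L²`, the integral over `τ` of `|K (t - τ) * h (τ - s)|` is bounded uniformly in `t`, and `γ` is
integrable. -/
lemma integrable_prod_kernel {K γ h : ℝ → ℝ} {M : ℝ} (hK : Measurable K) (hM : ∀ u, |K u| ≤ M)
    (hγ : Integrable γ) (hh : MemLp h 1 ∨ MemLp h 2 ∧ MemLp K 2) (s : ℝ) :
    Integrable (fun p : ℝ × ℝ ↦ K (p.2 - p.1) * γ p.2 * h (p.1 - s)) (volume.prod volume) := by
  obtain hh | ⟨hh, hK2⟩ := hh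
  · have h₁ : Integrable (fun p : ℝ × ℝ ↦ h (p.1 - s) * γ p.2) (volume.prod volume) :=
      ((memLp_one_iff_integrable.1 hh).comp_sub_right s).mul_prod hγ
    refine (h₁.bdd_mul (c := M) (f := fun p : ℝ × ℝ ↦ K (p.2 - p.1))
      (hK.comp (measurable_snd.sub measurable_fst)).aestronglyMeasurable
      (ae_of_all _ fun p ↦ hM _)).congr (ae_of_all _ fun p ↦ ?_)
    simp only
    ring
  · have hhs : MemLp (fun τ ↦ h (τ - s)) 2 :=
      hh.comp_measurePreserving (measurePreserving_sub_right volume s)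
    have hKt (t : ℝ) : MemLp (fun τ ↦ K (t - τ)) 2 :=
      hK2.comp_measurePreserving (Measure.measurePreserving_sub_left volume t)
    have hm : AEStronglyMeasurable
        (fun p : ℝ × ℝ ↦ K (p.2 - p.1) * γ p.2 * h (p.1 - s)) (volume.prod volume) :=
      ((hK.comp (measurable_snd.sub measurable_fst)).aestronglyMeasurable.mul
        hγ.1.comp_snd).mul hhs.1.comp_fst
    refine (integrable_prod_iff' hm).2 ⟨ae_of_all _ fun t ↦ ?_, ?_⟩
    · refine (((hKt t).integrable_mul hhs).const_mul (γ t)).congr (ae_of_all _ fun τ ↦ ?_)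
      simp only [Pi.mul_apply]
      ring
    · refine (hγ.norm.mul_const (((∫ u, K u ^ 2) + ∫ u, h u ^ 2) / 2)).mono'
        hm.norm.prod_swap.integral_prod_right' (ae_of_all _ fun t ↦ ?_)
      rw [Real.norm_of_nonneg (integral_nonneg fun _ ↦ norm_nonneg _)]
      have e (τ : ℝ) : ‖K (t - τ) * γ t * h (τ - s)‖ = ‖γ t‖ * |K (t - τ) * h (τ - s)| := by
        simp only [norm_mul, Real.norm_eq_abs, abs_mul]
        ring
      simp only [e]
      rw [integral_const_mul]
      gcongr
      have h₁ := integral_sub_left_eq_self (fun u ↦ K u ^ 2) volume t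
      have h₂ := integral_sub_right_eq_self (μ := volume) (fun u ↦ h u ^ 2) s
      rw [← h₁, ← h₂]
      exact integral_abs_mul_le_add_sq_div_two (hKt t) hhs

/-- If `h` is orthogonal to all translates of `γ`, it is orthogonal to all translates of the
correlation of `γ` with a kernel. -/
lemma integral_correlation_mul_eq_zero {K γ h : ℝ → ℝ} {s : ℝ}
    (hint : Integrable (fun p : ℝ × ℝ ↦ K (p.2 - p.1) * γ p.2 * h (p.1 - s))
      (volume.prod volume)) (hγh : ∀ v, ∫ r, h r * γ (r + v) = 0) :
    ∫ τ, correlation K γ τ * h (τ - s) = 0 := by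
  have h₁ : Integrable (fun p : ℝ × ℝ ↦ K p.2 * γ (p.2 + p.1) * h (p.1 - s))
      (volume.prod volume) := by
    -- The shear `(τ, u) ↦ (τ, τ + u)` preserves Lebesgue measure and transports `hint` to the
    -- shifted form.
    refine ((measurePreserving_prod_add volume volume).integrable_comp_of_integrable hint).congr
      (ae_of_all _ fun p ↦ ?_)
    simp [add_comm]
  have h₂ (τ : ℝ) : correlation K γ τ * h (τ - s) = ∫ u, K u * γ (u + τ) * h (τ - s) := by
    rw [correlation_eq, integral_mul_const]
  simp only [h₂]
  rw [integral_integral_swap h₁]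
  refine integral_eq_zero_of_ae (ae_of_all _ fun u ↦ ?_)
  simp only [mul_assoc, integral_const_mul, Pi.zero_apply]
  have h₃ : ∫ τ, γ (u + τ) * h (τ - s) = ∫ r, h r * γ (r + (u + s)) := by
    rw [← integral_sub_right_eq_self (fun r ↦ h r * γ (r + (u + s))) s]
    congr 1 with τ
    rw [mul_comm]
    congr 2
    ring
  rw [h₃, hγh, mul_zero]

end Correlation

/-- Truncation makes even an `L²` filter integrable, so the truncated convolutions are path
integrals. -/
lemma integrable_indicator_translate {h : ℝ → ℝ} (hh : MemLp h 1 ∨ MemLp h 2) (a b s : ℝ) :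
    Integrable ((Set.Ioc a b).indicator fun τ ↦ h (τ - s)) := by
  rw [integrable_indicator_iff measurableSet_Ioc]
  obtain hh | hh := hh
  · exact ((memLp_one_iff_integrable.1 hh).comp_sub_right s).integrableOn
  · have hhs : MemLp (fun τ ↦ h (τ - s)) 2 :=
      hh.comp_measurePreserving (measurePreserving_sub_right volume s)
    exact (hhs.restrict (Set.Ioc a b)).integrable one_le_two

lemma pathIntegral_indicator {Ω : Type*} {x : ℝ → Ω → ℝ} {a b : ℝ} (hab : a ≤ b)
    (w : ℝ → ℝ) (ω : Ω) :
    pathIntegral x ((Set.Ioc a b).indicator w) ω = ∫ τ in a..b, x τ ω * w τ := by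
  rw [intervalIntegral.integral_of_le hab, ← integral_indicator measurableSet_Ioc, pathIntegral]
  congr 1 with τ
  by_cases hτ : τ ∈ Set.Ioc a b <;> simp [hτ]

lemma windowedSpectrum_zero {Ω : Type*} {x : ℝ → Ω → ℝ} (w : ℝ → ℝ) :
    windowedSpectrum x w 0 = fun ω ↦ (pathIntegral x w ω : ℂ) := by
  ext ω
  simp only [windowedSpectrum, Real.fourier_real_eq_integral_exp_smul, pathIntegral,
    ← integral_complex_ofReal]
  congr 1 with t
  simp [mul_comm]

/-! ### From recovery to the kernel -/

section Main

variable {Ω : Type*} [MeasurableSpace Ω] {μ : Measure Ω} [IsProbabilityMeasure μ]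
  {x f : ℝ → Ω → ℝ} {Kx h : ℝ → ℝ}

namespace IsSource

lemma integral_pathIntegral (hx : IsSource μ x Kx) {w : ℝ → ℝ} (hw : Integrable w) :
    ∫ ω, pathIntegral x w ω ∂μ = 0 := by
  simpa [hx.mean_zero] using hx.integral_mul_pathIntegral (memLp_const (1 : ℝ)) hw

lemma integral_pathIntegral_mul_pathIntegral (hx : IsSource μ x Kx) {γ w : ℝ → ℝ}
    (hγ : Integrable γ) (hw : Integrable w) :
    ∫ ω, pathIntegral x γ ω * pathIntegral x w ω ∂μ = ∫ τ, correlation Kx γ τ * w τ := by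
  rw [hx.integral_mul_pathIntegral (hx.memLp_pathIntegral hγ) hw]
  congr 1 with τ
  congr 1
  simp only [mul_comm (pathIntegral x γ _)]
  rw [hx.integral_mul_pathIntegral (hx.memLp τ) hγ, correlation]
  congr 1 with t
  rw [← hx.integral_mul]
  simp only [mul_comm]

/-- A covariance kernel is bounded by `Kx 0`, so an integrable one is square integrable. -/
lemma memLp_two_kernel (hx : IsSource μ x Kx) (hK : MemLp Kx 1 ∨ MemLp Kx 2) : MemLp Kx 2 := by
  obtain hK | hK := hK
  · refine (memLp_two_iff_integrable_sq hK.1).2 ?_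
    simp only [sq]
    exact (memLp_one_iff_integrable.1 hK).bdd_mul hK.1 (ae_of_all _ hx.abs_kernel_le)
  · exact hK

end IsSource

/-- If the filter is orthogonal to all translates of `γ`, then `∫ x(t) γ(t) dt` is independent of
the observations. -/
lemma indepFun_observation (hx : IsSource μ x Kx) (hf : IsConvolution μ x h f)
    (hK : MemLp Kx 1 ∨ MemLp Kx 2) (hh : MemLp h 1 ∨ MemLp h 2) {v : ℝ≥0} {N : ℕ} {t : Fin N → ℝ}
    {y : Fin N → Ω → ℝ} (hy : IsObservation μ x f v t y) {γ : ℝ → ℝ} (hγ : Integrable γ)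
    (hγh : ∀ u, ∫ r, h r * γ (r + u) = 0) :
    IndepFun (pathIntegral x γ) (fun ω i ↦ y i ω) μ := by
  have hg (k : ℕ) (i : Fin N) :
      Integrable ((Set.Ioc (-(k : ℝ)) k).indicator fun τ ↦ h (τ - t i)) :=
    integrable_indicator_translate hh _ _ _
  have hle (k : ℕ) : -(k : ℝ) ≤ k := by linarith [k.cast_nonneg (α := ℝ)]
  have hR : Tendsto (fun k : ℕ ↦ (k : ℝ)) atTop atTop := tendsto_natCast_atTop_atTop
  have := hx.indepFun_pathIntegral hγ hg (fun i ↦ hf.measurable (t i))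
    (fun i ↦ (hy.measurable i).sub (hf.measurable (t i))) hy.indep_source (fun i ↦ ?_) fun i ↦ ?_
  · simpa using! this
  · refine ((hf.tendsto (t i)).comp hR).congr_left fun k ↦ ae_of_all _ fun ω ↦ ?_
    exact (pathIntegral_indicator (hle k) _ ω).symm
  · have hint := integrable_prod_kernel hx.measurable_kernel hx.abs_kernel_le hγ
      (hh.imp_right fun h ↦ ⟨h, hx.memLp_two_kernel hK⟩) (t i)
    have hint' : Integrable fun τ ↦ correlation Kx γ τ * h (τ - t i) := by
      refine hint.integral_prod_left.congr (ae_of_all _ fun τ ↦ ?_)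
      simp only [integral_mul_const, correlation]
    -- The covariance of `Z` with a truncated convolution is a truncation of an integral whose full
    -- value is `0`; it need only vanish in the limit.
    have hlim := intervalIntegral_tendsto_integral hint' (tendsto_neg_atTop_atBot.comp hR) hR
    rw [integral_correlation_mul_eq_zero hint hγh] at hlim
    refine hlim.congr fun k ↦ ?_
    rw [hx.integral_pathIntegral_mul_pathIntegral hγ (hg k i), Function.comp_apply,
      intervalIntegral.integral_of_le (hle k), ← integral_indicator measurableSet_Ioc]
    congr 1 with τ
    by_cases hτ : τ ∈ Set.Ioc (-(k : ℝ)) k <;> simp [hτ]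

/-- The covariance kernel annihilates every test function all of whose translates are annihilated
by the filter. -/
lemma integral_kernel_mul_eq_zero (hx : IsSource μ x Kx) (hf : IsConvolution μ x h f)
    (hK : MemLp Kx 1 ∨ MemLp Kx 2) (hh : MemLp h 1 ∨ MemLp h 2) {v : ℝ≥0}
    {t : (N : ℕ) → Fin N → ℝ} {y : (N : ℕ) → Fin N → Ω → ℝ}
    (hy : ∀ N, IsObservation μ x f v (t N) (y N)) (hrec : SuccessfullyRecovered μ x y)
    {γ : ℝ → ℝ} (hγ : Integrable γ) (hγc : Continuous γ) {C : ℝ}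
    (hC : ∀ t, |γ t| ≤ C * (1 + t ^ 2)⁻¹) (hγh : ∀ u, ∫ r, h r * γ (r + u) = 0) :
    ∫ u, Kx u * γ u = 0 := by
  have hzero {a b : ℝ} (hab : a ≤ b) : ∫ τ in a..b, correlation Kx γ τ = 0 := by
    set w : ℝ → ℝ := (Set.Ioc a b).indicator fun _ ↦ 1 with hw
    have hwi : Integrable w := by
      rw [hw, integrable_indicator_iff measurableSet_Ioc]
      exact integrableOn_const (by simp)
    have hwc : HasCompactSupport w := HasCompactSupport.intro isCompact_Icc fun τ hτ ↦
      Set.indicator_of_notMem (fun h ↦ hτ (Set.Ioc_subset_Icc_self h)) _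
    -- At frequency `0` the windowed spectrum is the real path integral of `w`.
    have h₁ := hrec 0 w hwi hwc
    rw [windowedSpectrum_zero] at h₁
    have h₂ := integral_mul_eq_zero_of_recovered (hx.memLp_pathIntegral hwi)
      (hx.memLp_pathIntegral hγ) (hx.integral_pathIntegral hγ) (fun N ↦ (hy N).measurable)
      (fun N ↦ indepFun_observation hx hf hK hh (hy N) hγ hγh) h₁
    rw [hx.integral_pathIntegral_mul_pathIntegral hγ hwi] at h₂
    rw [intervalIntegral.integral_of_le hab, ← integral_indicator measurableSet_Ioc, ← h₂]
    congr 1 with τ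
    by_cases hτ : τ ∈ Set.Ioc a b <;> simp [hw, hτ]
  have hzero' (b : ℝ) : ∫ τ in (0 : ℝ)..b, correlation Kx γ τ = 0 := by
    obtain hb | hb := le_total 0 b
    · exact hzero hb
    · rw [intervalIntegral.integral_symm, hzero hb, neg_zero]
  -- The primitive of the correlation is identically zero, and continuity at `0` identifies its
  -- derivative there with `correlation Kx γ 0`.
  have hderiv := intervalIntegral.integral_hasDerivAt_right (a := 0) (b := 0)
    (f := correlation Kx γ) IntervalIntegrable.refl
    (measurable_correlation hx.measurable_kernel
      hγc.measurable).stronglyMeasurable.stronglyMeasurableAtFilter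
    (continuousAt_correlation hx.measurable_kernel hx.abs_kernel_le hγc hC)
  simp only [hzero'] at hderiv
  simpa [correlation] using hderiv.unique (hasDerivAt_const (0 : ℝ) (0 : ℝ))

end Main

/-! ### Real and imaginary parts of the spectral pairing -/

lemma integrable_mul_schwartz {g : ℝ → ℝ} (hg : MemLp g 1 ∨ MemLp g 2) (φ : 𝓢(ℝ, ℂ)) :
    Integrable fun t ↦ (g t : ℂ) * φ t := by
  obtain hg | hg := hg
  · exact MemLp.integrable_mul hg.ofReal (φ.memLp ⊤)
  · exact MemLp.integrable_mul hg.ofReal (φ.memLp 2)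

lemma re_integral_mul_schwartz {g : ℝ → ℝ} (hg : MemLp g 1 ∨ MemLp g 2) (φ : 𝓢(ℝ, ℂ)) :
    (∫ t, (g t : ℂ) * φ t).re = ∫ t, g t * (φ t).re := by
  simpa using (integral_re (integrable_mul_schwartz hg φ)).symm

lemma im_integral_mul_schwartz {g : ℝ → ℝ} (hg : MemLp g 1 ∨ MemLp g 2) (φ : 𝓢(ℝ, ℂ)) :
    (∫ t, (g t : ℂ) * φ t).im = ∫ t, g t * (φ t).im := by
  simpa using (integral_im (integrable_mul_schwartz hg φ)).symm

end GPDeconv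

end

theorem theorem1 {Ω : Type*} [MeasurableSpace Ω] (μ : Measure Ω) [IsProbabilityMeasure μ]
    (x f : ℝ → Ω → ℝ) (Kx h : ℝ → ℝ) (v : ℝ≥0)
    (hKx : MemLp Kx 1 ∨ MemLp Kx 2) (hh : MemLp h 1 ∨ MemLp h 2)
    (t : (N : ℕ) → Fin N → ℝ) (y : (N : ℕ) → Fin N → Ω → ℝ)
    (hx : GPDeconv.IsSource μ x Kx)
    (hf : GPDeconv.IsConvolution μ x h f)
    (hy : ∀ N, GPDeconv.IsObservation μ x f v (t N) (y N))
    (hrec : GPDeconv.SuccessfullyRecovered μ x y) :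
    GPDeconv.spectralSupport Kx ⊆ GPDeconv.spectralSupport h := by
  intro ξ
  contrapose
  simp only [GPDeconv.spectralSupport, Distribution.notMem_dsupport_iff]
  rintro ⟨s, hs, hso, hξ⟩
  refine ⟨s, fun φ hφ ↦ ?_, hso, hξ⟩
  beta_reduce
  set g : 𝓢(ℝ, ℂ) := 𝓕 φ
  obtain ⟨C, hC⟩ := GPDeconv.exists_norm_le_inv_one_add_sq g
  -- Translates of `g` are Fourier transforms of modulations of `φ`, still supported in `s`, where
  -- `𝓕[h]` vanishes.
  have htr (u : ℝ) : ∃ ψ : 𝓢(ℝ, ℂ), (∀ r, ψ r = g (r + u)) ∧ ∫ r, (h r : ℂ) * ψ r = 0 := by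
    obtain ⟨ψ, hψ, hψ'⟩ := GPDeconv.exists_fourier_eq_translate φ u
    exact ⟨𝓕 ψ, hψ', hs ψ (hψ.trans hφ)⟩
  have key {γ : ℝ → ℝ} := GPDeconv.integral_kernel_mul_eq_zero hx hf hKx hh hy hrec (γ := γ)
  -- Path integrals take real weights, so the real and imaginary parts of `g` are used separately.
  apply Complex.ext
  · rw [GPDeconv.re_integral_mul_schwartz hKx, Complex.zero_re]
    refine key g.integrable.re (Complex.continuous_re.comp g.continuous)
      (fun t ↦ (Complex.abs_re_le_norm _).trans (hC t)) fun u ↦ ?_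
    obtain ⟨ψ, hψ, hψ0⟩ := htr u
    simp only [← hψ, ← GPDeconv.re_integral_mul_schwartz hh, hψ0, Complex.zero_re]
  · rw [GPDeconv.im_integral_mul_schwartz hKx, Complex.zero_im]
    refine key g.integrable.im (Complex.continuous_im.comp g.continuous)
      (fun t ↦ (Complex.abs_im_le_norm _).trans (hC t)) fun u ↦ ?_
    obtain ⟨ψ, hψ, hψ0⟩ := htr u
    simp only [← hψ, ← GPDeconv.im_integral_mul_schwartz hh, hψ0, Complex.zero_im]
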